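/- Let $n,m\ge 0$ be integers and let $a_0,a_1,\dots,a_n$ be nonnegative integers with sum $a=a_0+a_1+\cdots+a_n$. Let $I=\{i_1,\dots,i_m\}\subseteq\{0,1,\dots,n\}$ with $i_1<\cdots<i_m$, and let $J=\{j_1,\dots,j_m\}$ be a multiset of elements of $\{0,1,\dots,n\}\setminus I$ with $j_1\le\cdots\le j_m$. Then $$\Big(1+a-\sum_{k\in I}a_k\Big)\,\mathop{\mathrm{CT}}_{\mathbf x}\ \prod_{k=1}^m\Big(1-\frac{x_{j_k}}{x_{i_k}}\Big)\prod_{0\le i\ne j\le n}\Big(1-\frac{x_i}{x_j}\Big)^{a_i}=(1+a)\,\frac{a!}{a_0!\,a_1!\cdots a_n!},$$ where the second product is over all ordered pairs $(i,j)$ of distinct indices and $\mathop{\mathrm{CT}}_{\mathbf x}f$ denotes the constant term of the Laurent polynomial $f$ in the variables $x_0,\dots,x_n$. -/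

import Mathlib

/-- Laurent polynomials in the commuting variables `x_0, …, x_n` with rational coefficients:
finite formal sums of monomials `x ^ e` with exponent vector `e : Fin (n + 1) → ℤ`. -/
abbrev LaurentPoly (n : ℕ) : Type := AddMonoidAlgebra ℚ (Fin (n + 1) → ℤ)

namespace LaurentPoly

/-- The variable `x_i`. -/
noncomputable def x {n : ℕ} (i : Fin (n + 1)) : LaurentPoly n :=
  AddMonoidAlgebra.single (Pi.single i 1) 1

/-- The Laurent monomial `x_i / x_j`. -/
noncomputable def ratio {n : ℕ} (i j : Fin (n + 1)) : LaurentPoly n :=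
  AddMonoidAlgebra.single (Pi.single i 1 - Pi.single j 1) 1

/-- `x_i / x_j` is indeed the quotient of the two variables. -/
theorem ratio_mul_x {n : ℕ} (i j : Fin (n + 1)) : ratio i j * x j = x i := by
  simp [ratio, x, AddMonoidAlgebra.single_mul_single]

/-- The constant term of a Laurent polynomial: the coefficient of the monomial `x ^ 0`. -/
noncomputable def constantTerm {n : ℕ} (f : LaurentPoly n) : ℚ :=
  f.coeff 0

/-- The Dyson product `∏_{0 ≤ i ≠ j ≤ n} (1 - x_i / x_j) ^ a_i`, over all ordered pairs of distinct
indices. -/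
noncomputable def dysonProduct {n : ℕ} (a : Fin (n + 1) → ℕ) : LaurentPoly n :=
  ∏ p ∈ (Finset.univ : Finset (Fin (n + 1))).offDiag, (1 - ratio p.1 p.2) ^ a p.1

end LaurentPoly

namespace LaurentPoly

open Finset

variable {n : ℕ}

/-! The proof adapts Good's argument for the Dyson constant term. Let U be the support of a, let P
be the product of the factors 1 - x_{j i}/x_i over i in S ⊆ U, and let D_a be the Dyson product.
Lagrange interpolation at the nodes x_u, u ∈ U, gives D_a = Σ_u D_{a-e_u} when U is everything.
Otherwise it leaves an error of degree at most -#U in the variables outside U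
(`dysonProduct_sub_sum_lower_degLE`). Since P has degree at most #S in those variables, the error
can reach the constant term only if S = U, where it contributes exactly CT D_a
(`constantTerm_ratioProduct_mul_dysonProduct_recursion`). If a_i = 0 for some i ∈ S, the factor at i
can be dropped (`constantTerm_ratioProduct_erase`). The closed form obeys the same rules, so
induction on Σ a and on S finishes. -/

/-- Every exponent occurring in `f` has weight at most `d`. -/
def DegLE (w : (Fin (n + 1) → ℤ) →+ ℤ) (d : ℤ) (f : LaurentPoly n) : Prop :=
  ∀ e, f.coeff e ≠ 0 → w e ≤ d

/-! ### Calculus of weight bounds -/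

namespace DegLE

variable {w : (Fin (n + 1) → ℤ) →+ ℤ} {d d' : ℤ} {f g : LaurentPoly n}

theorem mono (hf : DegLE w d f) (h : d ≤ d') : DegLE w d' f := fun e he => (hf e he).trans h

theorem congr (hf : DegLE w d f) (h : f = g) : DegLE w d g := h ▸ hf

theorem zero : DegLE w d (0 : LaurentPoly n) := fun e he => by simp at he

theorem add (hf : DegLE w d f) (hg : DegLE w d g) : DegLE w d (f + g) := by
  intro e he
  by_cases h : f.coeff e = 0
  · exact hg e fun h' => he (by simp [h, h'])
  · exact hf e h

theorem neg (hf : DegLE w d f) : DegLE w d (-f) := fun e he => hf e (by simpa using he)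

theorem sub (hf : DegLE w d f) (hg : DegLE w d g) : DegLE w d (f - g) := by
  simpa [sub_eq_add_neg] using hf.add hg.neg

theorem sum {κ : Type*} {s : Finset κ} {f : κ → LaurentPoly n}
    (h : ∀ k ∈ s, DegLE w d (f k)) : DegLE w d (∑ k ∈ s, f k) :=
  Finset.sum_induction _ _ (fun _ _ => add) zero h

theorem single {e : Fin (n + 1) → ℤ} (h : w e ≤ d) (c : ℚ) :
    DegLE w d (AddMonoidAlgebra.single e c) := by
  classical
  intro e' he'
  rw [AddMonoidAlgebra.coeff_single, Finsupp.single_apply] at he'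
  split_ifs at he' with h'
  · exact h' ▸ h
  · simp at he'

theorem one (h : 0 ≤ d) : DegLE w d (1 : LaurentPoly n) := by
  rw [AddMonoidAlgebra.one_def]
  exact single (by simpa using h) 1

theorem mul (hf : DegLE w d f) (hg : DegLE w d' g) : DegLE w (d + d') (f * g) := by
  classical
  intro e he
  obtain ⟨p, hp, q, hq, rfl⟩ := Finset.mem_add.1
    (AddMonoidAlgebra.support_coeff_mul_subset f g (Finsupp.mem_support_iff.2 he))
  rw [map_add]
  exact add_le_add (hf p (Finsupp.mem_support_iff.1 hp)) (hg q (Finsupp.mem_support_iff.1 hq))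

theorem prod {κ : Type*} {s : Finset κ} {f : κ → LaurentPoly n} {d : κ → ℤ}
    (h : ∀ k ∈ s, DegLE w (d k) (f k)) : DegLE w (∑ k ∈ s, d k) (∏ k ∈ s, f k) := by
  classical
  induction s using Finset.induction_on with
  | empty => simpa using one le_rfl
  | insert k s hk ih =>
    rw [sum_insert hk, prod_insert hk]
    exact (h k (mem_insert_self k s)).mul (ih fun l hl => h l (mem_insert_of_mem hl))

theorem prod_zero {κ : Type*} {s : Finset κ} {f : κ → LaurentPoly n}
    (h : ∀ k ∈ s, DegLE w 0 (f k)) : DegLE w 0 (∏ k ∈ s, f k) := by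
  simpa using prod h

theorem pow_zero (hf : DegLE w 0 f) (k : ℕ) : DegLE w 0 (f ^ k) := by
  simpa using prod_zero (s := range k) fun _ _ => hf

/-- A product of factors 1 + (lower) is 1 + (lower); `d ≤ 0` lets the cross terms, of weight 2d,
stay below d. -/
theorem prod_sub_one {κ : Type*} {s : Finset κ} {f : κ → LaurentPoly n} (hd : d ≤ 0)
    (h : ∀ k ∈ s, DegLE w d (f k - 1)) : DegLE w d (∏ k ∈ s, f k - 1) := by
  classical
  induction s using Finset.induction_on with
  | empty => simpa using zero
  | insert k s hk ih =>
    have ih := ih fun l hl => h l (mem_insert_of_mem hl)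
    rw [prod_insert hk, show f k * ∏ x ∈ s, f x - 1
      = (f k - 1) * (∏ x ∈ s, f x - 1) + (f k - 1) + (∏ x ∈ s, f x - 1) by ring]
    have hk := h k (mem_insert_self k s)
    exact (((hk.mul ih).mono (by linarith)).add hk).add ih

theorem pow_sub_one (hd : d ≤ 0) (h : DegLE w d (f - 1)) (k : ℕ) : DegLE w d (f ^ k - 1) := by
  simpa using prod_sub_one (s := range k) hd fun _ _ => h

theorem constantTerm_eq_zero (hf : DegLE w d f) (hd : d < 0) : constantTerm f = 0 := by
  by_contra h
  have := hf 0 h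
  rw [map_zero] at this
  omega

end DegLE

@[simp] theorem constantTerm_zero : constantTerm (0 : LaurentPoly n) = 0 := by
  simp [constantTerm]

@[simp] theorem constantTerm_one : constantTerm (1 : LaurentPoly n) = 1 := by
  simp [constantTerm, AddMonoidAlgebra.one_def]

@[simp] theorem constantTerm_add (f g : LaurentPoly n) :
    constantTerm (f + g) = constantTerm f + constantTerm g := by
  simp [constantTerm]

@[simp] theorem constantTerm_sub (f g : LaurentPoly n) :
    constantTerm (f - g) = constantTerm f - constantTerm g := by
  simp [constantTerm]

theorem constantTerm_sum {κ : Type*} (s : Finset κ) (f : κ → LaurentPoly n) :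
    constantTerm (∑ k ∈ s, f k) = ∑ k ∈ s, constantTerm (f k) := by
  classical
  induction s using Finset.induction_on with
  | empty => simp
  | insert k s hk ih => rw [sum_insert hk, sum_insert hk, constantTerm_add, ih]

theorem DegLE.ratio {w : (Fin (n + 1) → ℤ) →+ ℤ} {d : ℤ} {u v : Fin (n + 1)}
    (h : w (Pi.single u 1) - w (Pi.single v 1) ≤ d) : DegLE w d (ratio u v) :=
  DegLE.single (by rwa [map_sub]) 1

theorem DegLE.one_sub_ratio {w : (Fin (n + 1) → ℤ) →+ ℤ} {d : ℤ} {u v : Fin (n + 1)}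
    (hd : 0 ≤ d) (h : w (Pi.single u 1) - w (Pi.single v 1) ≤ d) :
    DegLE w d (1 - LaurentPoly.ratio u v) :=
  (DegLE.one hd).sub (.ratio h)

/-! ### Factoring the Dyson product, and Lagrange interpolation -/

/-- The product of `(1 - x_u / x_v) ^ a_u` over the pairs `u ∈ U`, `v ∈ V` with `u ≠ v`. -/
noncomputable def pairProduct (U V : Finset (Fin (n + 1))) (a : Fin (n + 1) → ℕ) :
    LaurentPoly n :=
  ∏ u ∈ U, ∏ v ∈ V.erase u, (1 - ratio u v) ^ a u

/-- The tuple `a` with its entry at `u` lowered by one. -/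
def lower (a : Fin (n + 1) → ℕ) (u : Fin (n + 1)) : Fin (n + 1) → ℕ :=
  Function.update a u (a u - 1)

theorem dysonProduct_eq_pairProduct (a : Fin (n + 1) → ℕ) :
    dysonProduct a = pairProduct univ univ a := by
  rw [dysonProduct, pairProduct, Finset.prod_sigma']
  refine Finset.prod_bij' (fun p _ => ⟨p.1, p.2⟩) (fun q _ => (q.1, q.2)) ?_ ?_ ?_ ?_ ?_
  all_goals simp [ne_comm]

theorem dysonProduct_eq_mul {U : Finset (Fin (n + 1))} {a : Fin (n + 1) → ℕ}
    (h : ∀ v ∉ U, a v = 0) :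
    dysonProduct a = pairProduct U U a * pairProduct U Uᶜ a := by
  rw [dysonProduct_eq_pairProduct, pairProduct, pairProduct, pairProduct, ← prod_mul_distrib,
    ← prod_subset (subset_univ U) fun v _ hv => prod_eq_one fun _ _ => by rw [h v hv, pow_zero]]
  refine prod_congr rfl fun u hu => ?_
  have hu' : u ∉ Uᶜ := by simpa using hu
  rw [erase_eq_of_notMem hu', ← prod_union (disjoint_compl_right.mono_left (erase_subset u U))]
  congr 1
  ext v
  by_cases hv : v ∈ U
  · simp [hv]
  · simp [hv, ne_of_mem_of_not_mem hu hv |>.symm]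

theorem pairProduct_lower_mul {U : Finset (Fin (n + 1))} (V : Finset (Fin (n + 1)))
    {a : Fin (n + 1) → ℕ} {u : Fin (n + 1)} (hu : u ∈ U) (ha : a u ≠ 0) :
    pairProduct U V (lower a u) * ∏ v ∈ V.erase u, (1 - ratio u v) = pairProduct U V a := by
  rw [pairProduct, pairProduct, ← mul_prod_erase U _ hu, ← mul_prod_erase U _ hu, mul_right_comm,
    ← prod_mul_distrib]
  congr 1
  · refine prod_congr rfl fun v _ => ?_
    rw [← pow_succ, lower, Function.update_self, Nat.sub_add_cancel (Nat.pos_of_ne_zero ha)]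
  · refine prod_congr rfl fun u' hu' => ?_
    rw [lower, Function.update_of_ne (ne_of_mem_erase hu')]

-- Lowering a_u divides the product by ∏ (1 - x_u/x_v), and the reciprocal of that is the Lagrange
-- basis polynomial at x_u evaluated at 0. So this is interpolation of f at 0, done in the fraction
-- field.
open Polynomial in
theorem sum_pairProduct_lower_mul_eval {U : Finset (Fin (n + 1))} {a : Fin (n + 1) → ℕ}
    (ha : ∀ u ∈ U, a u ≠ 0) {f : (LaurentPoly n)[X]} (hf : f.degree < #U) :
    ∑ u ∈ U, pairProduct U U (lower a u) * f.eval (x u) = pairProduct U U a * f.eval 0 := by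
  let φ := algebraMap (LaurentPoly n) (FractionRing (LaurentPoly n))
  have hφ : Function.Injective φ := IsFractionRing.injective _ _
  have hx : Function.Injective (x : Fin (n + 1) → LaurentPoly n) := by
    intro u v huv
    have h := AddMonoidAlgebra.single_left_injective (R := ℚ) one_ne_zero huv
    by_contra hne
    simpa [hne] using congrFun h u
  have hx0 (u : Fin (n + 1)) : (x u : LaurentPoly n) ≠ 0 := by
    intro h
    simpa [x] using congrArg (fun f => f.coeff (Pi.single u 1)) h
  have key := congrArg (eval 0) (Lagrange.eq_interpolate (s := U) (v := fun u => φ (x u))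
    (f := f.map φ) ((hφ.comp hx).injOn) ((degree_map_le).trans_lt hf))
  rw [Lagrange.interpolate_apply, eval_finsetSum] at key
  apply hφ
  rw [map_sum, map_mul, ← eval_map_apply, map_zero, key, mul_sum]
  refine sum_congr rfl fun u hu => ?_
  rw [eval_mul, eval_C, map_mul, ← pairProduct_lower_mul U hu (ha u hu), map_mul, ← eval_map_apply,
    mul_assoc, mul_left_comm _ (eval _ _), Lagrange.basis, eval_prod, map_prod, ← prod_mul_distrib,
    prod_eq_one, mul_one]
  intro v hv
  have hne : φ (x u) - φ (x v) ≠ 0 :=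
    sub_ne_zero.2 fun h => ne_of_mem_erase hv (hx (hφ h)).symm
  have hr : φ (ratio u v) * φ (x v) = φ (x u) := by rw [← map_mul, ratio_mul_x]
  rw [Lagrange.basisDivisor, eval_mul, eval_C, eval_sub, eval_X, eval_C, map_sub, map_one]
  field_simp
  linear_combination hr

/-! ### Degree in the variables outside the support -/

/-- The total exponent of the variables indexed by `Z`. -/
def partialDegree (Z : Finset (Fin (n + 1))) : (Fin (n + 1) → ℤ) →+ ℤ where
  toFun e := ∑ z ∈ Z, e z
  map_zero' := by simp
  map_add' e e' := by simp [sum_add_distrib]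

theorem partialDegree_single (Z : Finset (Fin (n + 1))) (u : Fin (n + 1)) :
    partialDegree Z (Pi.single u 1) = if u ∈ Z then 1 else 0 := by
  simp [partialDegree, Pi.single_apply]

theorem pairProduct_degLE {w : (Fin (n + 1) → ℤ) →+ ℤ} {U V : Finset (Fin (n + 1))}
    (h : ∀ u ∈ U, ∀ v ∈ V, w (Pi.single u 1) ≤ w (Pi.single v 1)) (a : Fin (n + 1) → ℕ) :
    DegLE w 0 (pairProduct U V a) := by
  refine .prod_zero fun u hu => .prod_zero fun v hv => .pow_zero ?_ _
  exact .one_sub_ratio le_rfl (sub_nonpos.2 (h u hu v (mem_of_mem_erase hv)))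

theorem pairProduct_self_degLE (U : Finset (Fin (n + 1))) (a : Fin (n + 1) → ℕ) :
    DegLE (partialDegree Uᶜ) 0 (pairProduct U U a) :=
  pairProduct_degLE (fun u hu v hv => by simp [partialDegree_single, hu, hv]) a

theorem pairProduct_compl_sub_one_degLE (U : Finset (Fin (n + 1))) (a : Fin (n + 1) → ℕ) :
    DegLE (partialDegree Uᶜ) (-1) (pairProduct U Uᶜ a - 1) := by
  refine .prod_sub_one (by simp) fun u hu => .prod_sub_one (by simp) fun v hv =>
    .pow_sub_one (by simp) ?_ _
  rw [sub_sub_cancel_left]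
  have hv' : v ∉ U := by simpa using mem_of_mem_erase hv
  exact (DegLE.ratio (by simp [partialDegree_single, hu, hv'])).neg

theorem pairProduct_compl_degLE (U : Finset (Fin (n + 1))) (a : Fin (n + 1) → ℕ) :
    DegLE (partialDegree Uᶜ) 0 (pairProduct U Uᶜ a) :=
  pairProduct_degLE (fun u hu v hv => by
    simp [partialDegree_single, hu, show v ∉ U by simpa using hv]) a

/-! ### Geometric expansion and the error term -/

/-- The exponents `b` supported outside `U` with entries at most `#U`. -/
def boundedExponents (U : Finset (Fin (n + 1))) : Finset (Fin (n + 1) → ℕ) :=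
  Fintype.piFinset fun z => if z ∈ U then {0} else range (#U + 1)

theorem mem_boundedExponents {U : Finset (Fin (n + 1))} {b : Fin (n + 1) → ℕ} :
    b ∈ boundedExponents U ↔ (∀ z ∈ U, b z = 0) ∧ ∀ z ∉ U, b z ≤ #U := by
  rw [boundedExponents, Fintype.mem_piFinset, ← forall_and]
  refine forall_congr' fun z => ?_
  by_cases hz : z ∈ U <;> simp [hz]

/-- The Laurent monomial `∏ x_z ^ (-b_z)`. -/
noncomputable def invMonomial (b : Fin (n + 1) → ℕ) : LaurentPoly n :=
  AddMonoidAlgebra.single (fun z => -(b z : ℤ)) 1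

theorem x_pow (u : Fin (n + 1)) (q : ℕ) :
    (x u : LaurentPoly n) ^ q = AddMonoidAlgebra.single (Pi.single u (q : ℤ)) 1 := by
  rw [x, AddMonoidAlgebra.single_pow, one_pow]
  congr 1
  rw [← Pi.single_smul]
  simp

theorem prod_single_one {κ : Type*} (s : Finset κ) (e : κ → Fin (n + 1) → ℤ) :
    ∏ k ∈ s, (AddMonoidAlgebra.single (e k) 1 : LaurentPoly n) =
      AddMonoidAlgebra.single (∑ k ∈ s, e k) 1 := by
  classical
  induction s using Finset.induction_on with
  | empty => simp [AddMonoidAlgebra.one_def]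
  | insert k s hk ih =>
    rw [prod_insert hk, sum_insert hk, ih, AddMonoidAlgebra.single_mul_single, one_mul]

theorem prod_ratio_pow (u : Fin (n + 1)) (b : Fin (n + 1) → ℕ) :
    ∏ z, (ratio u z : LaurentPoly n) ^ b z = invMonomial b * x u ^ ∑ z, b z := by
  rw [x_pow, invMonomial, AddMonoidAlgebra.single_mul_single, one_mul,
    prod_congr rfl fun z _ => by rw [ratio, AddMonoidAlgebra.single_pow, one_pow],
    prod_single_one]
  congr 1
  ext v
  rw [Finset.sum_apply]
  simp [Pi.single_apply, mul_sub, sum_sub_distrib]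
  by_cases h : v = u
  · simp [h]; ring
  · simp [h]

theorem invMonomial_degLE {U : Finset (Fin (n + 1))} {b : Fin (n + 1) → ℕ}
    (hb : b ∈ boundedExponents U) :
    DegLE (partialDegree Uᶜ) (-(∑ z, b z : ℕ)) (invMonomial b) := by
  refine .single ?_ 1
  rw [← sum_subset (subset_univ Uᶜ) fun z _ hz =>
    (mem_boundedExponents.1 hb).1 z (by simpa using hz)]
  simp [partialDegree]

/-- The truncated geometric series approximating `∏ z ∉ U, (1 - x_u / x_z)⁻¹`. -/
noncomputable def truncatedInverse (U : Finset (Fin (n + 1))) (u : Fin (n + 1)) :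
    LaurentPoly n :=
  ∏ z ∈ Uᶜ, ∑ q ∈ range (#U + 1), ratio u z ^ q

theorem truncatedInverse_eq_sum (U : Finset (Fin (n + 1))) (u : Fin (n + 1)) :
    truncatedInverse U u = ∑ b ∈ boundedExponents U, invMonomial b * x u ^ ∑ z, b z := by
  simp_rw [← prod_ratio_pow]
  rw [boundedExponents, ← prod_univ_sum, truncatedInverse]
  rw [← prod_subset (subset_univ Uᶜ)]
  · refine prod_congr rfl fun z hz => ?_
    rw [if_neg (by simpa using hz)]
  · intro z _ hz
    rw [if_pos (by simpa using hz)]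
    simp

/-- Truncating each geometric series after the power #U leaves 1 - ∏ (1 - (x_u/x_z)^(#U+1)), whose
weight is at most -(#U+1). -/
theorem pairProduct_compl_lower_degLE {U : Finset (Fin (n + 1))} {a : Fin (n + 1) → ℕ}
    {u : Fin (n + 1)} (hu : u ∈ U) (ha : a u ≠ 0) :
    DegLE (partialDegree Uᶜ) (-(#U + 1 : ℕ))
      (pairProduct U Uᶜ (lower a u) - pairProduct U Uᶜ a * truncatedInverse U u) := by
  rw [← pairProduct_lower_mul Uᶜ hu ha, erase_eq_of_notMem (by simpa using hu), truncatedInverse,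
    mul_assoc, ← prod_mul_distrib]
  simp_rw [mul_neg_geom_sum]
  rw [← mul_one_sub, ← neg_sub, mul_neg]
  refine DegLE.neg ?_
  rw [← zero_add (-(#U + 1 : ℕ) : ℤ)]
  refine (pairProduct_compl_degLE U _).mul (.prod_sub_one (by simp) fun z hz => ?_)
  have hz' : z ∉ U := by simpa using hz
  rw [sub_sub_cancel_left, ratio, AddMonoidAlgebra.single_pow]
  refine (DegLE.single ?_ _).neg
  rw [map_nsmul, map_sub, partialDegree_single, partialDegree_single]
  simp [hu, hz']

/-- The sum of the monomials of degree `#U` in the inverses of the variables outside `U`. -/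
noncomputable def leadingSum (U : Finset (Fin (n + 1))) : LaurentPoly n :=
  ∑ b ∈ boundedExponents U with ∑ z, b z = #U, invMonomial b

theorem leadingSum_degLE (U : Finset (Fin (n + 1))) :
    DegLE (partialDegree Uᶜ) (-#U) (leadingSum U) := by
  refine .sum fun b hb => ?_
  rw [mem_filter] at hb
  simpa [hb.2] using invMonomial_degLE hb.1

-- X^#U is one degree too high to interpolate. Subtracting the nodal polynomial lowers the degree
-- without changing the values at the nodes, and changes the value at 0 by ±∏ x_u.
open Polynomial in
theorem sum_pairProduct_lower_mul_pow_card {U : Finset (Fin (n + 1))} {a : Fin (n + 1) → ℕ}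
    (ha : ∀ u ∈ U, a u ≠ 0) (hU : U.Nonempty) :
    ∑ u ∈ U, pairProduct U U (lower a u) * x u ^ #U =
      -((-1) ^ #U * (∏ u ∈ U, x u) * pairProduct U U a) := by
  have hdeg : (∏ u ∈ U, (X - C (x u : LaurentPoly n))).degree = (#U : WithBot ℕ) := by
    rw [degree_prod_of_monic _ _ fun u _ => monic_X_sub_C _]
    simp
  have h := sum_pairProduct_lower_mul_eval ha
    (f := X ^ #U - ∏ u ∈ U, (X - C (x u : LaurentPoly n))) (by
      conv_rhs => rw [← degree_X_pow (R := LaurentPoly n) #U]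
      refine degree_sub_lt_left ?_ ?_ ?_
      · rw [hdeg, degree_X_pow]
      · exact (monic_X_pow _).ne_zero
      · rw [(monic_X_pow _).leadingCoeff, (monic_prod_of_monic _ _ fun u _ =>
          monic_X_sub_C _).leadingCoeff])
  simp only [eval_sub, eval_pow, eval_X, eval_prod, eval_C, zero_sub] at h
  rw [zero_pow hU.card_ne_zero, zero_sub, prod_neg] at h
  rw [← sub_eq_zero, ← sub_eq_zero.2 h]
  rw [sub_eq_sub_iff_sub_eq_sub, ← sum_sub_distrib, sum_eq_zero]
  · ring
  · intro u hu
    rw [prod_eq_zero hu (sub_self _)]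
    ring

theorem sum_pairProduct_lower_mul_pow {U : Finset (Fin (n + 1))} {a : Fin (n + 1) → ℕ}
    (ha : ∀ u ∈ U, a u ≠ 0) {p : ℕ} (hp : p < #U) :
    ∑ u ∈ U, pairProduct U U (lower a u) * x u ^ p = pairProduct U U a * 0 ^ p := by
  simpa using sum_pairProduct_lower_mul_eval ha (f := Polynomial.X ^ p)
    (by rw [Polynomial.degree_X_pow]; exact_mod_cast hp)

/-- Compare coefficients of each inverse monomial of degree p: for p < #U interpolation leaves only
the term 1, p = #U gives the leading sum, and p > #U is within the bound. -/
theorem sum_pairProduct_lower_mul_truncatedInverse_degLE {U : Finset (Fin (n + 1))}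
    {a : Fin (n + 1) → ℕ} (ha : ∀ u ∈ U, a u ≠ 0) (hU : U.Nonempty) :
    DegLE (partialDegree Uᶜ) (-(#U + 1 : ℕ))
      (pairProduct U U a - ∑ u ∈ U, pairProduct U U (lower a u) * truncatedInverse U u -
        (-1) ^ #U * (∏ u ∈ U, x u) * pairProduct U U a * leadingSum U) := by
  have h0 : (0 : Fin (n + 1) → ℕ) ∈ boundedExponents U := by simp [mem_boundedExponents]
  have h1 : pairProduct U U a =
      ∑ b ∈ boundedExponents U, if b = 0 then pairProduct U U a else 0 := by
    rw [sum_ite_eq', if_pos h0]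
  have h2 : ∑ u ∈ U, pairProduct U U (lower a u) * truncatedInverse U u =
      ∑ b ∈ boundedExponents U,
        invMonomial b * ∑ u ∈ U, pairProduct U U (lower a u) * x u ^ ∑ z, b z := by
    simp_rw [truncatedInverse_eq_sum, mul_sum]
    rw [sum_comm]
    exact sum_congr rfl fun _ _ => sum_congr rfl fun _ _ => mul_left_comm _ _ _
  rw [h2, leadingSum, mul_sum, sum_filter]
  nth_rw 1 [h1]
  rw [← sum_sub_distrib, ← sum_sub_distrib]
  refine .sum fun b hb => ?_
  have hb0 : b = 0 ↔ ∑ z, b z = 0 := by simp [funext_iff]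
  rcases lt_trichotomy (∑ z, b z) #U with h | h | h
  · rw [sum_pairProduct_lower_mul_pow ha h, if_neg h.ne]
    by_cases hb' : b = 0
    · have : invMonomial (0 : Fin (n + 1) → ℕ) = 1 := by
        simp [invMonomial, AddMonoidAlgebra.one_def, ← Pi.zero_def]
      simpa [hb', this] using DegLE.zero
    · rw [if_neg hb', zero_pow (mt hb0.2 hb')]
      simpa using DegLE.zero
  · rw [h, sum_pairProduct_lower_mul_pow_card ha hU, if_pos rfl,
      if_neg (mt hb0.1 (h ▸ hU.card_ne_zero))]
    convert DegLE.zero using 1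
    ring
  · rw [if_neg h.ne', sub_zero, if_neg (mt hb0.1 (by omega)), zero_sub]
    refine (((invMonomial_degLE hb).mul (.sum fun u hu => (pairProduct_self_degLE U _).mul
      (d' := 0) ?_)).mono ?_).neg
    · rw [x_pow]
      refine .single ?_ 1
      simp [partialDegree, Pi.single_apply, hu]
    · zify at h
      push_cast
      linarith

theorem dysonProduct_sub_sum_lower_degLE {U : Finset (Fin (n + 1))}
    {a : Fin (n + 1) → ℕ} (ha : ∀ u, u ∈ U ↔ a u ≠ 0) (hU : U.Nonempty) :
    DegLE (partialDegree Uᶜ) (-(#U + 1 : ℕ))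
      (dysonProduct a - ∑ u ∈ U, dysonProduct (lower a u) -
        (-1) ^ #U * (∏ u ∈ U, x u) * pairProduct U U a * leadingSum U) := by
  have hE := pairProduct_compl_sub_one_degLE U a
  have hx : DegLE (partialDegree Uᶜ) 0 (∏ u ∈ U, x u : LaurentPoly n) :=
    .prod_zero fun u hu => .single (by simp [partialDegree_single, hu]) 1
  have hsign : DegLE (partialDegree Uᶜ) 0 ((-1) ^ #U : LaurentPoly n) :=
    .pow_zero (DegLE.one le_rfl).neg _
  have hlow : ∀ u ∈ U, dysonProduct (lower a u) =
      pairProduct U U (lower a u) * pairProduct U Uᶜ (lower a u) := fun u hu =>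
    dysonProduct_eq_mul fun v hv => by
      rw [lower, Function.update_of_ne (ne_of_mem_of_not_mem hu hv).symm]
      simpa using mt (ha v).2 hv
  have h1 : DegLE (partialDegree Uᶜ) (-(#U + 1 : ℕ)) (∑ u ∈ U, pairProduct U U (lower a u) *
      (pairProduct U Uᶜ (lower a u) - pairProduct U Uᶜ a * truncatedInverse U u)) :=
    .sum fun u hu => ((pairProduct_self_degLE U _).mul
      (pairProduct_compl_lower_degLE hu ((ha u).1 hu))).mono (zero_add _).le
  have h2 := (pairProduct_compl_degLE U a).mul
    (sum_pairProduct_lower_mul_truncatedInverse_degLE (fun u hu => (ha u).1 hu) hU)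
  -- Replacing the cross product over U and its complement by 1 in the leading term costs one
  -- further degree.
  have h3 := (((hsign.mul hx).mul (pairProduct_self_degLE U a)).mul
    (leadingSum_degLE U)).mul hE
  refine ((h2.mono (zero_add _).le).add ((h3.mono ?_).sub h1)).congr ?_
  · push_cast
    linarith
  · rw [dysonProduct_eq_mul fun v hv => by simpa using mt (ha v).2 hv, sum_congr rfl hlow]
    simp_rw [mul_sub, sum_sub_distrib, mul_sum]
    rw [sum_congr rfl fun u _ => mul_left_comm (pairProduct U U (lower a u)) _ _]
    ring

/-! ### Constant terms with the extra factors -/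

/-- The product of `1 - x_{j i} / x_i` over `i ∈ S`. -/
noncomputable def ratioProduct (S : Finset (Fin (n + 1))) (j : Fin (n + 1) → Fin (n + 1)) :
    LaurentPoly n :=
  ∏ i ∈ S, (1 - ratio (j i) i)

theorem ratioProduct_degLE {S U : Finset (Fin (n + 1))} (hS : S ⊆ U)
    (j : Fin (n + 1) → Fin (n + 1)) : DegLE (partialDegree Uᶜ) #S (ratioProduct S j) := by
  have h : ∀ i ∈ S, DegLE (partialDegree Uᶜ) 1 (1 - ratio (j i) i) := fun i hi => by
    refine .one_sub_ratio zero_le_one ?_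
    simp only [partialDegree_single, mem_compl, hS hi, not_true_eq_false, if_false, sub_zero]
    split_ifs <;> simp
  simpa [ratioProduct] using DegLE.prod h

/-- Every other term of the expansion takes a 1 from some factor and so loses a unit of weight. -/
theorem prod_one_sub_sub_prod_neg_degLE {κ : Type*} {w : (Fin (n + 1) → ℤ) →+ ℤ} (s : Finset κ)
    {f : κ → LaurentPoly n} (h : ∀ k ∈ s, DegLE w 1 (f k)) :
    DegLE w (#s - 1) (∏ k ∈ s, (1 - f k) - ∏ k ∈ s, -f k) := by
  classical
  induction s using Finset.induction_on with
  | empty => simpa using DegLE.zero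
  | insert k s hk ih =>
    have hs : ∀ l ∈ s, DegLE w 1 (f l) := fun l hl => h l (mem_insert_of_mem hl)
    have h1 : DegLE w #s (∏ l ∈ s, (1 - f l)) := by
      simpa using DegLE.prod fun l hl => (DegLE.one zero_le_one).sub (hs l hl)
    have h2 := (h k (mem_insert_self k s)).mul (ih hs)
    rw [prod_insert hk, prod_insert hk, card_insert_of_notMem hk]
    refine ((h1.mono ?_).sub (h2.mono ?_)).congr (by ring) <;> push_cast <;> linarith

theorem DegLE.single_mul {e : Fin (n + 1) → ℤ} {w : (Fin (n + 1) → ℤ) →+ ℤ} {d : ℤ}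
    {f : LaurentPoly n} (hf : DegLE w 0 f) (he : w e ≤ d) :
    DegLE w d (AddMonoidAlgebra.single e 1 * f) :=
  ((DegLE.single he 1).mul hf).mono (add_zero d).le

theorem constantTerm_single_mul_pairProduct {U : Finset (Fin (n + 1))} {a : Fin (n + 1) → ℕ}
    {e : Fin (n + 1) → ℤ} {z : Fin (n + 1)} (hz : z ∉ U) (he : e z ≠ 0) :
    constantTerm (AddMonoidAlgebra.single e 1 * pairProduct U U a) = 0 := by
  have hne : ∀ u ∈ U, z ≠ u := fun u hu => (ne_of_mem_of_not_mem hu hz).symm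
  rcases he.lt_or_gt with h | h
  · refine (DegLE.single_mul (w := Pi.evalAddMonoidHom _ z)
      (pairProduct_degLE ?_ a) le_rfl).constantTerm_eq_zero h
    intro u hu v hv
    simp [hne u hu, hne v hv]
  · refine (DegLE.single_mul (w := -Pi.evalAddMonoidHom _ z)
      (pairProduct_degLE ?_ a) le_rfl).constantTerm_eq_zero (by simpa using h)
    intro u hu v hv
    simp [hne u hu, hne v hv]

/-- Only the inverse monomial whose exponents are the multiplicities of the values `j i` cancels the
product; any other leaves a nonzero power of a variable outside U. -/
theorem constantTerm_prod_x_mul_leadingSum {U : Finset (Fin (n + 1))}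
    {j : Fin (n + 1) → Fin (n + 1)} (hj : ∀ i ∈ U, j i ∉ U) (a : Fin (n + 1) → ℕ) :
    constantTerm ((∏ i ∈ U, x (j i)) * pairProduct U U a * leadingSum U) =
      constantTerm (pairProduct U U a) := by
  let c : Fin (n + 1) → ℕ := fun z => #{i ∈ U | j i = z}
  have hx : ∏ i ∈ U, (x (j i) : LaurentPoly n) =
      AddMonoidAlgebra.single (fun z => (c z : ℤ)) 1 := by
    simp only [x]
    rw [prod_single_one]
    congr 1
    ext z
    rw [Finset.sum_apply]
    simp only [c, Pi.single_apply, sum_boole, eq_comm]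
  have hc0 : ∀ z ∈ U, c z = 0 := fun z hz => by
    rw [card_eq_zero, filter_eq_empty_iff]
    rintro i hi rfl
    exact hj i hi hz
  have hc : c ∈ boundedExponents U ∧ ∑ z, c z = #U :=
    ⟨mem_boundedExponents.2 ⟨hc0, fun z _ => card_filter_le _ _⟩,
      (card_eq_sum_card_fiberwise fun _ _ => mem_coe.2 (mem_univ _)).symm⟩
  rw [leadingSum, mul_sum, constantTerm_sum, sum_eq_single c]
  · rw [hx, mul_right_comm, invMonomial, AddMonoidAlgebra.single_mul_single, one_mul]
    rw [show ((fun z => (c z : ℤ)) + fun z => -(c z : ℤ)) = 0 from funext fun z => add_neg_cancel _,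
      ← AddMonoidAlgebra.one_def, one_mul]
  · intro b hb hbc
    rw [mem_filter, mem_boundedExponents] at hb
    obtain ⟨z, hz⟩ := Function.ne_iff.1 hbc
    rw [hx, mul_right_comm, invMonomial, AddMonoidAlgebra.single_mul_single, one_mul]
    refine constantTerm_single_mul_pairProduct (z := z)
      (fun hzU => hz ((hb.1.1 z hzU).trans (hc0 z hzU).symm)) ?_
    simp only [Pi.add_apply]
    omega
  · exact fun h => (h (mem_filter.2 hc)).elim

theorem constantTerm_dysonProduct_eq {U : Finset (Fin (n + 1))} {a : Fin (n + 1) → ℕ}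
    (h : ∀ v ∉ U, a v = 0) :
    constantTerm (dysonProduct a) = constantTerm (pairProduct U U a) := by
  rw [← sub_eq_zero, ← constantTerm_sub, dysonProduct_eq_mul h, ← mul_sub_one]
  exact ((pairProduct_self_degLE U a).mul
    (pairProduct_compl_sub_one_degLE U a)).constantTerm_eq_zero (by simp)

/-- Only the top part ∏ (-x_{j i}/x_i) offsets the degree -#U; its denominators cancel ∏ x_u and the
two signs cancel. -/
theorem constantTerm_ratioProduct_self_mul {U : Finset (Fin (n + 1))}
    {j : Fin (n + 1) → Fin (n + 1)} (hj : ∀ i ∈ U, j i ∉ U) (a : Fin (n + 1) → ℕ) :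
    constantTerm (ratioProduct U j *
      ((-1) ^ #U * (∏ u ∈ U, x u) * pairProduct U U a * leadingSum U)) =
      constantTerm (pairProduct U U a) := by
  have hx : DegLE (partialDegree Uᶜ) 0 (∏ u ∈ U, x u : LaurentPoly n) :=
    .prod_zero fun u hu => .single (by simp [partialDegree_single, hu]) 1
  have hsign : DegLE (partialDegree Uᶜ) 0 ((-1) ^ #U : LaurentPoly n) :=
    .pow_zero (DegLE.one le_rfl).neg _
  have htop := prod_one_sub_sub_prod_neg_degLE (w := partialDegree Uᶜ) U
    (f := fun i => ratio (j i) i) fun i hi => .ratio (by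
      simp [partialDegree_single, hi, hj i hi])
  have h := (htop.mul (((hsign.mul hx).mul (pairProduct_self_degLE U a)).mul
    (leadingSum_degLE U))).constantTerm_eq_zero (by linarith)
  rw [sub_mul, constantTerm_sub, sub_eq_zero] at h
  rw [ratioProduct, h, ← constantTerm_prod_x_mul_leadingSum hj, prod_neg,
    prod_congr rfl fun i _ => (ratio_mul_x (j i) i).symm, prod_mul_distrib]
  have hs : ((-1) ^ #U * (-1) ^ #U : LaurentPoly n) = 1 := by rw [← mul_pow]; simp
  have hring : ∀ s r y p l : LaurentPoly n, s * s = 1 →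
      s * r * (s * y * p * l) = r * y * p * l := fun s r y p l h => by
    linear_combination r * y * p * l * h
  rw [hring _ _ _ _ _ hs]

theorem constantTerm_ratioProduct_mul_dysonProduct_recursion {S U : Finset (Fin (n + 1))}
    {a : Fin (n + 1) → ℕ} {j : Fin (n + 1) → Fin (n + 1)} (ha : ∀ u, u ∈ U ↔ a u ≠ 0)
    (hU : U.Nonempty) (hS : S ⊆ U) (hj : ∀ i ∈ S, j i ∉ S) :
    constantTerm (ratioProduct S j * dysonProduct a) =
      ∑ u ∈ U, constantTerm (ratioProduct S j * dysonProduct (lower a u)) +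
        if S = U then constantTerm (dysonProduct a) else 0 := by
  have hcard := card_le_card hS
  have h := ((ratioProduct_degLE hS j).mul
    (dysonProduct_sub_sum_lower_degLE ha hU)).constantTerm_eq_zero (by push_cast; omega)
  rw [mul_sub, mul_sub, constantTerm_sub, constantTerm_sub, mul_sum, constantTerm_sum] at h
  have hlead : constantTerm (ratioProduct S j *
      ((-1) ^ #U * (∏ u ∈ U, x u) * pairProduct U U a * leadingSum U)) =
      if S = U then constantTerm (dysonProduct a) else 0 := by
    split_ifs with hSU
    · subst hSU
      rw [constantTerm_ratioProduct_self_mul hj,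
        constantTerm_dysonProduct_eq fun v hv => by simpa using mt (ha v).2 hv]
    · have hlt := card_lt_card (hS.ssubset_of_ne hSU)
      have hx : DegLE (partialDegree Uᶜ) 0 (∏ u ∈ U, x u : LaurentPoly n) :=
        .prod_zero fun u hu => .single (by simp [partialDegree_single, hu]) 1
      have hsign : DegLE (partialDegree Uᶜ) 0 ((-1) ^ #U : LaurentPoly n) :=
        .pow_zero (DegLE.one le_rfl).neg _
      exact ((ratioProduct_degLE hS j).mul (((hsign.mul hx).mul (pairProduct_self_degLE U a)).mul
        (leadingSum_degLE U))).constantTerm_eq_zero (by omega)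
  linarith

/-- Here x_i never occurs with positive exponent, so the terms containing x_{j i}/x_i cannot
contribute. -/
theorem constantTerm_ratioProduct_erase {S : Finset (Fin (n + 1))} {a : Fin (n + 1) → ℕ}
    {j : Fin (n + 1) → Fin (n + 1)} (hj : ∀ i ∈ S, j i ∉ S) {i : Fin (n + 1)} (hi : i ∈ S)
    (ha : a i = 0) :
    constantTerm (ratioProduct S j * dysonProduct a) =
      constantTerm (ratioProduct (S.erase i) j * dysonProduct a) := by
  let w : (Fin (n + 1) → ℤ) →+ ℤ := Pi.evalAddMonoidHom _ i
  have hji : ∀ k ∈ S, i ≠ j k := fun k hk h => hj k hk (h ▸ hi)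
  have hP : DegLE w 0 (ratioProduct (S.erase i) j) := .prod_zero fun k hk =>
    .one_sub_ratio le_rfl (by
      simp [w, hji k (mem_of_mem_erase hk), (ne_of_mem_erase hk).symm])
  have hr : DegLE w (-1) (ratio (j i) i : LaurentPoly n) := .ratio (by simp [w, hji i hi])
  have hD : DegLE w 0 (dysonProduct a) := .prod_zero fun p _ => by
    by_cases hp : p.1 = i
    · rw [hp, ha, pow_zero]
      exact .one le_rfl
    · refine .pow_zero (.one_sub_ratio le_rfl ?_) _
      simp only [w, Pi.evalAddMonoidHom_apply, Pi.single_apply, Ne.symm hp, if_false]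
      split_ifs <;> simp
  have h := ((hP.mul hr).mul hD).constantTerm_eq_zero (by simp)
  rw [← sub_eq_zero, ← constantTerm_sub, ratioProduct, ← mul_prod_erase S _ hi, ← ratioProduct,
    ← neg_eq_zero, ← h]
  rw [neg_eq_iff_add_eq_zero, ← constantTerm_add]
  convert constantTerm_zero
  ring

/-! ### The induction -/

theorem prod_factorial_eq_mul_lower {a : Fin (n + 1) → ℕ} {u : Fin (n + 1)} (hu : a u ≠ 0) :
    ∏ r, (a r).factorial = a u * ∏ r, (lower a u r).factorial := by
  rw [← mul_prod_erase univ _ (mem_univ u), ← mul_prod_erase univ _ (mem_univ u), ← mul_assoc,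
    lower, Function.update_self, Nat.mul_factorial_pred hu]
  congr 1
  exact prod_congr rfl fun r hr => by rw [Function.update_of_ne (ne_of_mem_erase hr)]

theorem sum_lower_add {a : Fin (n + 1) → ℕ} {u : Fin (n + 1)} (hu : a u ≠ 0)
    (s : Finset (Fin (n + 1))) :
    ∑ r ∈ s, lower a u r + (if u ∈ s then 1 else 0) = ∑ r ∈ s, a r := by
  rw [← sum_ite_eq' s u fun _ => 1, ← sum_add_distrib]
  refine sum_congr rfl fun r _ => ?_
  by_cases h : r = u
  · subst h
    rw [if_pos rfl, lower, Function.update_self]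
    omega
  · rw [if_neg h, lower, Function.update_of_ne h, add_zero]

theorem constantTerm_ratioProduct_mul_dysonProduct (N : ℕ) (a : Fin (n + 1) → ℕ)
    (hN : ∑ r, a r = N) (S : Finset (Fin (n + 1))) (j : Fin (n + 1) → Fin (n + 1))
    (hj : ∀ i ∈ S, j i ∉ S) :
    (1 + (∑ r ∈ Sᶜ, a r : ℕ)) * constantTerm (ratioProduct S j * dysonProduct a) *
      (∏ r, (a r).factorial : ℕ) = ((N + 1).factorial : ℚ) := by
  induction N using Nat.strong_induction_on generalizing a S with
  | _ N ihN =>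
  induction S using Finset.strongInduction with
  | H S ihS =>
  by_cases hS0 : ∃ i ∈ S, a i = 0
  · obtain ⟨i, hi, hai⟩ := hS0
    have h := ihS (S.erase i) (erase_ssubset hi) fun k hk hk' =>
      hj k (mem_of_mem_erase hk) (mem_of_mem_erase hk')
    rwa [compl_erase, sum_insert (by simpa using hi), hai, zero_add,
      ← constantTerm_ratioProduct_erase hj hi hai] at h
  push Not at hS0
  let U : Finset (Fin (n + 1)) := {u | a u ≠ 0}
  have hU : ∀ u, u ∈ U ↔ a u ≠ 0 := fun u => by simp [U]
  have hSU : S ⊆ U := fun i hi => (hU i).2 (hS0 i hi)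
  rcases U.eq_empty_or_nonempty with hU0 | hU0
  · have ha : a = 0 := funext fun u => by
      by_contra h
      have := (hU u).2 h
      simp [hU0] at this
    have hS : S = ∅ := subset_empty.1 (hU0 ▸ hSU)
    subst hN ha hS
    simp [ratioProduct, dysonProduct]
  have hsplit : ∑ r ∈ S, a r + ∑ r ∈ Sᶜ, a r = N := by rw [sum_add_sum_compl, hN]
  -- Lowering a_u lowers the sum over the complement of S only if u ∉ S, so the prefactor 1 + s
  -- becomes s + [u ∈ S].
  have hlow : ∀ u ∈ U, ((∑ r ∈ Sᶜ, a r : ℕ) + if u ∈ S then 1 else 0) *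
      constantTerm (ratioProduct S j * dysonProduct (lower a u)) * (∏ r, (a r).factorial : ℕ) =
        a u * (N.factorial : ℚ) := by
    intro u hu
    have hu := (hU u).1 hu
    have h1 := sum_lower_add hu univ
    rw [if_pos (mem_univ u), hN] at h1
    have h := ihN _ (by omega) (lower a u) rfl S hj
    rw [h1] at h
    have h2 : (∑ r ∈ Sᶜ, a r : ℕ) + (if u ∈ S then 1 else 0 : ℕ) =
        1 + ∑ r ∈ Sᶜ, lower a u r := by
      rw [← sum_lower_add hu]
      by_cases h : u ∈ S <;> simp [h] <;> ring
    have h3 : ((∑ r ∈ Sᶜ, a r : ℕ) : ℚ) + (if u ∈ S then 1 else 0) =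
        1 + (∑ r ∈ Sᶜ, lower a u r : ℕ) := by exact_mod_cast h2
    rw [h3, prod_factorial_eq_mul_lower hu, ← h]
    push_cast
    ring
  have hsumU : ∀ s : Finset (Fin (n + 1)), ∑ u ∈ U with u ∈ s, a u = ∑ u ∈ s, a u := by
    intro s
    rw [filter_mem_eq_inter]
    exact sum_subset inter_subset_right fun u hu hu' => by
      by_contra h
      exact hu' (mem_inter.2 ⟨(hU u).2 h, hu⟩)
  rw [constantTerm_ratioProduct_mul_dysonProduct_recursion hU hU0 hSU hj, Nat.factorial_succ]
  by_cases hS : S = U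
  · have hs : ∑ r ∈ Sᶜ, a r = 0 := sum_eq_zero fun r hr => by
      by_contra h
      exact (mem_compl.1 hr) (hS ▸ (hU r).2 h)
    -- The extra term is Dyson's constant term for the same a: the case of empty S.
    have hdyson := ihS ∅ (hS ▸ empty_ssubset.2 hU0) (by simp)
    rw [compl_empty, hN, ratioProduct, prod_empty, one_mul, Nat.factorial_succ] at hdyson
    have hdyson : constantTerm (dysonProduct a) * (∏ r, (a r).factorial : ℕ) = N.factorial := by
      refine mul_left_cancel₀ (a := (1 + N : ℚ)) (by positivity) ?_
      rw [← mul_assoc, hdyson]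
      push_cast
      ring
    have hN' : ∑ u ∈ U, a u = N := by rw [← hS, ← hsplit, hs, add_zero]
    have hsum : ∑ u ∈ U, constantTerm (ratioProduct S j * dysonProduct (lower a u)) *
        (∏ r, (a r).factorial : ℕ) = N * (N.factorial : ℚ) := by
      rw [← hN', Nat.cast_sum, sum_mul, hN']
      refine sum_congr rfl fun u hu => ?_
      rw [← hlow u hu, hs, if_pos (hS ▸ hu), Nat.cast_zero, zero_add, one_mul]
    rw [if_pos hS, hs, Nat.cast_zero, add_zero, one_mul, add_mul, hdyson, sum_mul, hsum]
    push_cast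
    ring
  · obtain ⟨v, hvU, hvS⟩ := exists_of_ssubset (hSU.ssubset_of_ne hS)
    have hspos : (0 : ℚ) < (∑ r ∈ Sᶜ, a r : ℕ) := by
      exact_mod_cast (Nat.pos_of_ne_zero ((hU v).1 hvU)).trans_le
        (single_le_sum_of_canonicallyOrdered (mem_compl.2 hvS))
    generalize hs : ((∑ r ∈ Sᶜ, a r : ℕ) : ℚ) = s at hspos hlow ⊢
    -- The prefactor is 1 + s for u ∈ S and s otherwise; s(1 + s) clears both, and s > 0 because S ≠
    -- U.
    have hterm : ∀ u ∈ U, s * (1 + s) *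
        (constantTerm (ratioProduct S j * dysonProduct (lower a u)) *
          (∏ r, (a r).factorial : ℕ)) =
        N.factorial * (s * a u + if u ∈ Sᶜ then (a u : ℚ) else 0) := by
      intro u hu
      have h := hlow u hu
      by_cases hu' : u ∈ S
      · simp only [hu', if_true, mem_compl, not_true_eq_false, if_false] at h ⊢
        linear_combination s * h
      · simp only [hu', if_true, mem_compl, not_false_eq_true, if_false] at h ⊢
        linear_combination (1 + s) * h
    have hsum := sum_congr rfl hterm
    have hN' : ∑ u ∈ U, (a u : ℚ) = N := by
      have := hsumU univ
      simp only [mem_univ, filter_true] at this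
      exact_mod_cast this.trans hN
    have hs' : ∑ u ∈ U with u ∈ Sᶜ, (a u : ℚ) = s := by
      rw [← hs]
      exact_mod_cast hsumU Sᶜ
    rw [← mul_sum, ← mul_sum, sum_add_distrib, ← mul_sum, ← sum_filter, hN', hs', ← sum_mul]
      at hsum
    rw [if_neg hS, add_zero]
    refine mul_left_cancel₀ hspos.ne' ?_
    push_cast at hsum ⊢
    linear_combination hsum

end LaurentPoly

theorem mainTheorem1 (n m : ℕ) (a : Fin (n + 1) → ℕ)
    (i j : Fin m → Fin (n + 1)) (hi : StrictMono i) (hj : Monotone j)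
    (hij : ∀ k l : Fin m, j k ≠ i l) :
    (1 + ∑ r, (a r : ℚ) - ∑ k, (a (i k) : ℚ)) *
        LaurentPoly.constantTerm
          ((∏ k, (1 - LaurentPoly.ratio (j k) (i k))) * LaurentPoly.dysonProduct a) =
      (1 + ∑ r, (a r : ℚ)) *
        (((∑ r, a r).factorial : ℚ) / ∏ r, ((a r).factorial : ℚ)) := by
  let S : Finset (Fin (n + 1)) := Finset.univ.map ⟨i, hi.injective⟩
  -- The default `id` is never used: J is evaluated only on the range of `i`.
  let J : Fin (n + 1) → Fin (n + 1) := Function.extend i j id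
  have hJ : ∀ k, J (i k) = j k := hi.injective.extend_apply j id
  have hP : ∏ k, (1 - LaurentPoly.ratio (j k) (i k)) = LaurentPoly.ratioProduct S J := by
    simp [LaurentPoly.ratioProduct, S, hJ]
  have hs : 1 + ∑ r, (a r : ℚ) - ∑ k, (a (i k) : ℚ) = 1 + (∑ r ∈ Sᶜ, a r : ℕ) := by
    rw [← Finset.sum_add_sum_compl S]
    simp only [S, Finset.sum_map, Function.Embedding.coeFn_mk, Nat.cast_sum]
    ring
  have h := LaurentPoly.constantTerm_ratioProduct_mul_dysonProduct _ a rfl S J (by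
    simp only [S, Finset.mem_map, Finset.mem_univ, true_and, Function.Embedding.coeFn_mk]
    rintro _ ⟨k, rfl⟩ ⟨l, hl⟩
    exact hij k l ((hJ k).symm.trans hl.symm))
  have hne : ∏ r, ((a r).factorial : ℚ) ≠ 0 :=
    Finset.prod_ne_zero_iff.2 fun r _ => by exact_mod_cast (a r).factorial_ne_zero
  rw [hP, hs, ← mul_div_assoc, eq_div_iff hne]
  push_cast [Nat.factorial_succ] at h ⊢
  linear_combination h
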